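/- Let $G$ be a finite simple graph with $n$ vertices and let $k\ge 0$ be an integer. A \emph{restraint} on $G$ is a function $r$ assigning to each vertex $v$ a finite set $r(v)$ of positive integers (forbidden colours). It is a \emph{$k$-restraint} if $|r(v)|=k$ and $r(v)\subseteq\{1,\dots,kn\}$ for every $v\in V(G)$, and it is \emph{proper} if $r(u)\cap r(v)=\emptyset$ for every edge $uv$ of $G$. For $x\in\mathbb N$ let $\pi_r(G,x)$ be the number of proper colourings $c:V(G)\to\{1,\dots,x\}$ with $c(v)\notin r(v)$ for every $v\in V(G)$. Let $R_{\max}(G,k)$ be the set of all $k$-restraints $r$ on $G$ such that, for all sufficiently large $x$, $\pi_{r}(G,x)\ge\pi_{r'}(G,x)$ for every $k$-restraint $r'$ on $G$. For an enumeration $V(G)=\{u_1,\dots,u_n\}$ put $$A_7''(G,r)=-\sum_{i=1}^n\ \sum_{\substack{u_j,u_l\in N_G(u_i)\\ j<l}}|r(u_j)\cap r(u_l)|.$$ \textbf{Theorem.} If $r^*\in R_{\max}(G,k)$, then (i) $r^*$ is a proper restraint; (ii) $A_7''(G,r^*)=\min\{A_7''(G,r): r \text{ is a proper } k\text{-restraint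 on } G\}$; in other words, $$\sum_{u\in V(G)}\ \sum_{\substack{v,w\in N_G(u)\\ v\ne w}}|r^*(v)\cap r^*(w)|\ \ge\ \sum_{u\in V(G)}\ \sum_{\substack{v,w\in N_G(u)\\ v\ne w}}|r(v)\cap r(w)|$$ for every proper $k$-restraint $r$ on $G$. -/

import Mathlib

/-- `r` is a `k`-restraint: every `r v` is a `k`-element subset of `{1, …, k * n}`, where `n` is the
order of the graph with vertex set `V`. A restraint is a function `V → Finset ℕ`. -/
def IsKRestraint {V : Type*} [Fintype V] (k : ℕ) (r : V → Finset ℕ) : Prop :=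
  ∀ v, (r v).card = k ∧ r v ⊆ Finset.Icc 1 (k * Fintype.card V)

/-- `r` is a proper restraint on `G`: adjacent vertices have disjoint sets of forbidden colours. -/
def IsProperRestraint {V : Type*} (G : SimpleGraph V) (r : V → Finset ℕ) : Prop :=
  ∀ u v, G.Adj u v → r u ∩ r v = ∅

/-- The number of proper colourings of `G` with colours in `{1, …, x}` that are permitted by `r`. -/
noncomputable def restrainedCount {V : Type*} (G : SimpleGraph V) (r : V → Finset ℕ) (x : ℕ) : ℕ :=
  Nat.card {c : G.Coloring (Set.Icc 1 x) // ∀ v, (c v : ℕ) ∉ r v}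

/-- `R_max(G, k)`: the `k`-restraints on `G` that permit, among all `k`-restraints on `G`, the
largest number of `x`-colourings for all large enough `x`. -/
def RMax {V : Type*} [Fintype V] (G : SimpleGraph V) (k : ℕ) : Set (V → Finset ℕ) :=
  {r | IsKRestraint k r ∧ ∃ X : ℕ, ∀ x ≥ X, ∀ r' : V → Finset ℕ, IsKRestraint k r' →
    restrainedCount G r' x ≤ restrainedCount G r x}

/-- `A₇''(G, r) = - ∑_{u} ∑_{u_j, u_k ∈ N(u), j < k} |r(u_j) ∩ r(u_k)|`, with respect to an
enumeration `e` of the vertices (`u_j = e j`). -/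
def A7'' {V : Type*} [Fintype V] (G : SimpleGraph V) [DecidableRel G.Adj]
    (e : Fin (Fintype.card V) ≃ V) (r : V → Finset ℕ) : ℤ :=
  -∑ i, ∑ j, ∑ k with G.Adj (e i) (e j) ∧ G.Adj (e i) (e k) ∧ j < k,
    ((r (e j) ∩ r (e k)).card : ℤ)

/-- `∑_{u} ∑_{v, w ∈ N(u), v ≠ w} |r(v) ∩ r(w)|`, over ordered pairs `(v, w)`. -/
def neighborOverlap {V : Type*} [Fintype V] [DecidableEq V] (G : SimpleGraph V)
    [DecidableRel G.Adj] (r : V → Finset ℕ) : ℕ :=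
  ∑ u, ∑ v ∈ G.neighborFinset u, ∑ w ∈ G.neighborFinset u with v ≠ w, (r v ∩ r w).card

/-! Split the colours into the head `{1, …, kn}`, which contains every forbidden colour, and the
tail above it. Grouping colourings by the set `S` of vertices with head colours gives `∑ S,
headCount S * P S x`, where `P S x` does not depend on the restraint and grows like `x ^ (n - |S|)`
(`restrainedCount_eq_sum`). Hence a maximiser beats any competitor at the first size `|S| = j` where
the head counts can differ (`sum_headCount_le_of_mem_RMax`). Sizes 0 and 1 never differ. At size 2
each edge `ab` costs `|r a ∩ r b|`, so comparison with a pairwise disjoint restraint forces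
properness. Among proper restraints size 2 is constant too, and at size 3 the head count is a
constant plus half the neighbour overlap inside `S` (`two_mul_headCount_triple`); summing over `S`
gives the overlap inequality. -/

/-- The proper colourings of `H` in which every vertex `v` gets a colour from the list `L v`. -/
def listColorings {W : Type*} [Fintype W] [DecidableEq W] (H : SimpleGraph W)
    [DecidableRel H.Adj] (L : W → Finset ℕ) : Finset (W → ℕ) :=
  {c ∈ Fintype.piFinset L | ∀ u v, H.Adj u v → c u ≠ c v}

/-! ### List colourings and their splitting by colour classes -/

section
variable {W : Type*} [Fintype W] [DecidableEq W] (H : SimpleGraph W) [DecidableRel H.Adj]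

theorem mem_listColorings {L : W → Finset ℕ} {c : W → ℕ} :
    c ∈ listColorings H L ↔ (∀ v, c v ∈ L v) ∧ ∀ u v, H.Adj u v → c u ≠ c v := by
  simp [listColorings]

theorem restrainedCount_eq_card (r : W → Finset ℕ) (x : ℕ) :
    restrainedCount H r x = (listColorings H fun v => Finset.Icc 1 x \ r v).card := by
  rw [restrainedCount, ← Nat.card_eq_finsetCard]
  refine Nat.card_congr
    { toFun := fun c => ⟨fun v => (c.1 v : ℕ), (mem_listColorings H).2
        ⟨fun v => Finset.mem_sdiff.2 ⟨Finset.mem_Icc.2 (c.1 v).2, c.2 v⟩,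
          fun u v huv h => c.1.valid huv (Subtype.ext h)⟩⟩
      invFun := fun c =>
        have hc := (mem_listColorings H).1 c.2
        ⟨SimpleGraph.Coloring.mk
          (fun v => ⟨c.1 v, Finset.mem_Icc.1 (Finset.mem_sdiff.1 (hc.1 v)).1⟩)
          fun {u v} huv h => hc.2 u v huv (congrArg Subtype.val h),
          fun v => (Finset.mem_sdiff.1 (hc.1 v)).2⟩
      left_inv := fun c => rfl
      right_inv := fun c => rfl }

theorem card_listColorings_const_le (B : Finset ℕ) :
    (listColorings H fun _ => B).card ≤ B.card ^ Fintype.card W := by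
  refine (Finset.card_filter_le _ _).trans ?_
  simp

theorem descFactorial_le_card_listColorings_const (B : Finset ℕ) :
    B.card.descFactorial (Fintype.card W) ≤ (listColorings H fun _ => B).card := by
  have h : Fintype.card (W ↪ B) = B.card.descFactorial (Fintype.card W) := by simp
  rw [← h, ← Finset.card_univ]
  refine Finset.card_le_card_of_injOn (fun f w => (f w : ℕ)) ?_ ?_
  · intro f _
    rw [Finset.mem_coe, mem_listColorings]
    exact ⟨fun v => (f v).2, fun u v huv h => huv.ne (f.injective (Subtype.ext h))⟩
  · intro f _ g _ hfg
    ext w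
    exact congrFun hfg w

/-- Lists that are unions of two lists without common colours: a colouring is given by the set `S`
of the vertices coloured from the first lists and by colourings of the two induced subgraphs. -/
theorem card_listColorings_union (A B : W → Finset ℕ) (hAB : ∀ u v, Disjoint (A u) (B v)) :
    (listColorings H fun v => A v ∪ B v).card =
      ∑ S : Finset W,
        (listColorings (H.comap ((↑) : {v // v ∈ S} → W)) fun v => A v).card *
        (listColorings (H.comap ((↑) : {v // v ∉ S} → W)) fun v => B v).card := by
  have key := Finset.card_eq_sum_card_fiberwise
    (s := listColorings H fun v => A v ∪ B v) (t := Finset.univ)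
    (f := fun c => ({v | c v ∈ A v} : Finset W)) (fun _ _ => Finset.mem_coe.2 (Finset.mem_univ _))
  rw [key]
  refine Finset.sum_congr rfl fun S _ => ?_
  rw [← Finset.card_product]
  refine Finset.card_nbij' (fun c => (fun v => c v, fun v => c v))
    (fun p v => if h : v ∈ S then p.1 ⟨v, h⟩ else p.2 ⟨v, h⟩) ?_ ?_ ?_ ?_
  · intro c hc
    simp only [Finset.coe_filter, Set.mem_ofPred_eq, mem_listColorings, Finset.mem_union] at hc
    obtain ⟨⟨h1, h2⟩, rfl⟩ := hc
    simp only [Finset.coe_product, Set.mem_prod, Finset.mem_coe, mem_listColorings]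
    refine ⟨⟨fun v => ?_, fun u v huv => h2 _ _ huv⟩, ⟨fun v => ?_, fun u v huv => h2 _ _ huv⟩⟩
    · exact (Finset.mem_filter.1 v.2).2
    · have := v.2
      simp only [Finset.mem_filter, Finset.mem_univ, true_and] at this
      exact (h1 v).resolve_left this
  · rintro ⟨f, g⟩ hfg
    simp only [Finset.coe_product, Set.mem_prod, Finset.mem_coe, mem_listColorings] at hfg
    obtain ⟨⟨hf, hf'⟩, ⟨hg, hg'⟩⟩ := hfg
    simp only [Finset.coe_filter, Set.mem_ofPred_eq, mem_listColorings, Finset.mem_union]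
    refine ⟨⟨fun v => ?_, fun u v huv => ?_⟩, ?_⟩
    · by_cases h : v ∈ S
      · simpa [h] using Or.inl (hf ⟨v, h⟩)
      · simpa [h] using Or.inr (hg ⟨v, h⟩)
    · by_cases hu : u ∈ S <;> by_cases hv : v ∈ S <;> simp only [hu, hv, dite_true, dite_false]
      · exact hf' ⟨u, hu⟩ ⟨v, hv⟩ huv
      -- Edges between `S` and its complement impose no condition: their ends use disjoint lists.
      · exact Finset.disjoint_iff_ne.1 (hAB u v) _ (hf ⟨u, hu⟩) _ (hg ⟨v, hv⟩)
      · exact (Finset.disjoint_iff_ne.1 (hAB v u) _ (hf ⟨v, hv⟩) _ (hg ⟨u, hu⟩)).symm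
      · exact hg' ⟨u, hu⟩ ⟨v, hv⟩ huv
    · ext v
      by_cases h : v ∈ S
      · simpa [h] using hf ⟨v, h⟩
      · simpa [h] using fun h' => Finset.disjoint_left.1 (hAB v v) h' (hg ⟨v, h⟩)
  · intro c _
    ext v
    simp
  · rintro ⟨f, g⟩ _
    refine Prod.ext ?_ ?_
    · ext v
      simp
    · ext v
      simp [v.2]

end
-- Asymptotics and comparison of leading terms
open Filter Topology

theorem tendsto_natCast_sub_div (c : ℕ) :
    Tendsto (fun x : ℕ => ((x - c : ℕ) : ℝ) / x) atTop (𝓝 1) := by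
  have h : Tendsto (fun x : ℕ => 1 - (c : ℝ) / x) atTop (𝓝 (1 - 0)) :=
    tendsto_const_nhds.sub (tendsto_const_div_atTop_nhds_zero_nat _)
  rw [sub_zero] at h
  refine h.congr' ?_
  filter_upwards [eventually_ge_atTop (c + 1)] with x hx
  have hx' : (x : ℝ) ≠ 0 := by
    rw [Nat.cast_ne_zero]
    omega
  rw [Nat.cast_sub (by omega)]
  field_simp

/-- Edges do not affect the leading term: the count lies between the number of injections and the
number of all maps. -/
theorem tendsto_card_listColorings_Ioc {W : Type*} [Fintype W] [DecidableEq W]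
    (H : SimpleGraph W) [DecidableRel H.Adj] (N : ℕ) :
    Tendsto (fun x : ℕ => ((listColorings H fun _ => Finset.Ioc N x).card : ℝ) /
      (x : ℝ) ^ Fintype.card W) atTop (𝓝 1) := by
  set m := Fintype.card W
  -- The interval has `x - N` elements, and its falling factorial of length `m` is at least `(x - N
  -- + 1 - m) ^ m`; the 1 is dropped.
  have lower : Tendsto (fun x : ℕ => (((x - (N + m) : ℕ) : ℝ) / x) ^ m) atTop (𝓝 1) := by
    simpa using (tendsto_natCast_sub_div (N + m)).pow m
  refine tendsto_of_tendsto_of_tendsto_of_le_of_le lower tendsto_const_nhds ?_ ?_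
  · intro x
    simp only [div_pow]
    gcongr
    have h := descFactorial_le_card_listColorings_const H (Finset.Ioc N x)
    have h' := Nat.pow_sub_le_descFactorial (Finset.Ioc N x).card (Fintype.card W)
    have h'' : (x - (N + m)) ^ m ≤ ((Finset.Ioc N x).card + 1 - m) ^ m := by
      rw [Nat.card_Ioc]
      exact Nat.pow_le_pow_left (by omega) _
    exact_mod_cast h''.trans (h'.trans h)
  · intro x
    have h := card_listColorings_const_le H (Finset.Ioc N x)
    have h' : (Finset.Ioc N x).card ^ Fintype.card W ≤ x ^ m := by
      rw [Nat.card_Ioc]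
      exact Nat.pow_le_pow_left (by omega) _
    have h'' : ((listColorings H fun _ => Finset.Ioc N x).card : ℝ) ≤ (x : ℝ) ^ m := by
      exact_mod_cast h.trans h'
    exact div_le_one_of_le₀ h'' (by positivity)

/-- If `P S` grows like `x ^ (n - |S|)`, then an eventually nonnegative combination of the `P S`
whose coefficients vanish for `|S| < j` has a nonnegative coefficient sum over `|S| = j`. -/
theorem sum_powersetCard_nonneg {V : Type*} [Fintype V] (P : Finset V → ℕ → ℝ)
    (hP : ∀ S, Tendsto (fun x : ℕ => P S x / (x : ℝ) ^ (Fintype.card V - S.card)) atTop (𝓝 1))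
    (a : Finset V → ℝ) (j : ℕ) (ha : ∀ S, S.card < j → a S = 0)
    (hpos : ∀ᶠ x in atTop, 0 ≤ ∑ S, a S * P S x) :
    0 ≤ ∑ S ∈ Finset.powersetCard j Finset.univ, a S := by
  classical
  -- Normalised by `x ^ (n - j)`, larger sets vanish in the limit and smaller ones have zero
  -- coefficient. Writing `x ^ j / x ^ n` avoids truncated subtraction when `j > n`.
  have key : Tendsto (fun x : ℕ => ∑ S, a S * (P S x * (x : ℝ) ^ j / (x : ℝ) ^ Fintype.card V))
      atTop (𝓝 (∑ S, if S.card = j then a S else 0)) := by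
    refine tendsto_finsetSum _ fun S _ => ?_
    have hS : S.card ≤ Fintype.card V := Finset.card_le_univ S
    rcases lt_trichotomy S.card j with h | h | h
    · simp [ha S h]
    · simp only [h, if_true]
      refine (by simpa using (hP S).const_mul (a S) : Tendsto _ atTop (𝓝 (a S))).congr' ?_
      filter_upwards [eventually_gt_atTop 0] with x hx
      have hx' : (x : ℝ) ≠ 0 := by positivity
      congr 1
      rw [div_eq_div_iff (by positivity) (by positivity), mul_assoc, ← pow_add,
        show j + (Fintype.card V - S.card) = Fintype.card V by omega]
    · simp only [h.ne', if_false]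
      have h0 : Tendsto (fun x : ℕ => ((x : ℝ) ^ (S.card - j))⁻¹) atTop (𝓝 0) :=
        tendsto_inv_atTop_zero.comp
          ((tendsto_pow_atTop (by omega)).comp tendsto_natCast_atTop_atTop)
      have h1 := ((hP S).mul h0).const_mul (a S)
      rw [mul_zero, mul_zero] at h1
      refine h1.congr' ?_
      filter_upwards [eventually_gt_atTop 0] with x hx
      have hx' : (x : ℝ) ≠ 0 := by positivity
      congr 1
      rw [← div_eq_mul_inv, div_div, div_eq_div_iff (by positivity) (by positivity), mul_assoc,
        ← pow_add, ← pow_add,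
        show j + (Fintype.card V - S.card + (S.card - j)) = Fintype.card V by omega]
  have hlim := ge_of_tendsto (b := (0 : ℝ)) key (by
    filter_upwards [hpos] with x hx
    have : ∑ S, a S * (P S x * (x : ℝ) ^ j / (x : ℝ) ^ Fintype.card V) =
        (∑ S, a S * P S x) * ((x : ℝ) ^ j / (x : ℝ) ^ Fintype.card V) := by
      rw [Finset.sum_mul]
      exact Finset.sum_congr rfl fun S _ => by ring
    rw [this]
    positivity)
  rwa [← Finset.sum_filter, ← Finset.powerset_univ, ← Finset.powersetCard_eq_filter] at hlim

/-! ### Head counts and the consequence of maximality -/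

/-- The number of proper colourings of `G[S]` with colours in `{1, …, k * n}` permitted by `r`. -/
def headCount {V : Type*} [Fintype V] [DecidableEq V] (G : SimpleGraph V) [DecidableRel G.Adj]
    (k : ℕ) (r : V → Finset ℕ) (S : Finset V) : ℕ :=
  (listColorings (G.comap ((↑) : {v // v ∈ S} → V))
    fun v => Finset.Icc 1 (k * Fintype.card V) \ r v).card

section
variable {V : Type*} [Fintype V] [DecidableEq V] (G : SimpleGraph V) [DecidableRel G.Adj] {k : ℕ}

theorem restrainedCount_eq_sum {r : V → Finset ℕ} (hr : IsKRestraint k r) {x : ℕ}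
    (hx : k * Fintype.card V ≤ x) :
    restrainedCount G r x = ∑ S : Finset V, headCount G k r S *
      (listColorings (G.comap ((↑) : {v // v ∉ S} → V))
        fun _ => Finset.Ioc (k * Fintype.card V) x).card := by
  have h : (fun v => Finset.Icc 1 x \ r v) = fun v =>
      (Finset.Icc 1 (k * Fintype.card V) \ r v) ∪ Finset.Ioc (k * Fintype.card V) x := by
    ext v a
    have := @(hr v).2 a
    simp only [Finset.mem_sdiff, Finset.mem_union, Finset.mem_Icc, Finset.mem_Ioc] at this ⊢
    by_cases ha : a ∈ r v
    · have := this ha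
      simp only [ha, not_true, and_false, false_or, false_iff]
      omega
    · simp only [ha, not_false_eq_true, and_true]
      omega
  rw [restrainedCount_eq_card, h, card_listColorings_union]
  · rfl
  · intro u v
    refine Finset.disjoint_left.2 fun a ha hb => ?_
    simp only [Finset.mem_sdiff, Finset.mem_Icc, Finset.mem_Ioc] at ha hb
    omega

variable {G} in
theorem sum_headCount_le_of_mem_RMax {rstar r : V → Finset ℕ} (hstar : rstar ∈ RMax G k)
    (hr : IsKRestraint k r) (j : ℕ)
    (heq : ∀ S : Finset V, S.card < j → headCount G k r S = headCount G k rstar S) :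
    ∑ S ∈ Finset.powersetCard j Finset.univ, headCount G k r S ≤
      ∑ S ∈ Finset.powersetCard j Finset.univ, headCount G k rstar S := by
  obtain ⟨hstar, X, hX⟩ := hstar
  have h := sum_powersetCard_nonneg
    (fun S x => ((listColorings (G.comap ((↑) : {v // v ∉ S} → V))
        fun _ => Finset.Ioc (k * Fintype.card V) x).card : ℝ))
    (fun S => by
      have := tendsto_card_listColorings_Ioc (G.comap ((↑) : {v // v ∉ S} → V))
        (k * Fintype.card V)
      rwa [show Fintype.card {v // v ∉ S} = Fintype.card V - S.card by
        rw [Fintype.card_subtype_compl, Fintype.card_coe]] at this)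
    (fun S => (headCount G k rstar S : ℝ) - headCount G k r S) j
    (fun S hS => by simp [heq S hS])
    (by
      filter_upwards [eventually_ge_atTop X, eventually_ge_atTop (k * Fintype.card V)]
        with x hx hx'
      have := hX x hx r hr
      rw [restrainedCount_eq_sum G hr hx', restrainedCount_eq_sum G hstar hx'] at this
      simp only [sub_mul, Finset.sum_sub_distrib, sub_nonneg]
      exact_mod_cast this)
  simp only [Finset.sum_sub_distrib, sub_nonneg] at h
  exact_mod_cast h

end

/-! ### Explicit counts on at most three vertices -/

theorem card_filter_ne_prod (A B : Finset ℕ) (p : Prop) [Decidable p] :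
    (((A ×ˢ B).filter fun t => p → t.1 ≠ t.2).card : ℤ) =
      A.card * B.card - (if p then 1 else 0) * (A ∩ B).card := by
  have h : ∀ x y : ℕ, (if p → x ≠ y then (1 : ℤ) else 0) =
      1 - (if p then 1 else 0) * (if x = y then 1 else 0) := by
    intro x y
    by_cases hp : p <;> by_cases hxy : x = y <;> simp [hp, hxy]
  rw [Finset.card_filter, Finset.sum_product]
  push_cast
  simp only [h, Finset.sum_sub_distrib, ← Finset.mul_sum, Finset.sum_ite_eq, Finset.sum_const,
    Finset.sum_boole, Finset.filter_mem_eq_inter]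
  simp

/-- Inclusion–exclusion over the three possible equalities. Any two of them imply the third, so all
higher terms collapse onto `A ∩ B ∩ C`. -/
theorem card_filter_ne_prod_three (A B C : Finset ℕ) (p q s : Prop) [Decidable p] [Decidable q]
    [Decidable s] :
    (((A ×ˢ B ×ˢ C).filter fun t =>
      (p → t.1 ≠ t.2.1) ∧ (q → t.2.1 ≠ t.2.2) ∧ (s → t.1 ≠ t.2.2)).card : ℤ) =
    A.card * B.card * C.card - (if p then 1 else 0) * ((A ∩ B).card * C.card)
      - (if q then 1 else 0) * (A.card * (B ∩ C).card)
      - (if s then 1 else 0) * ((A ∩ C).card * B.card)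
      + ((if p ∧ q then 1 else 0) + (if q ∧ s then 1 else 0) + (if p ∧ s then 1 else 0)
        - (if p ∧ q ∧ s then 1 else 0)) * (A ∩ B ∩ C).card := by
  have h : ∀ x y z : ℕ, (if (p → x ≠ y) ∧ (q → y ≠ z) ∧ (s → x ≠ z) then (1 : ℤ) else 0) =
      1 - (if p then 1 else 0) * (if x = y then 1 else 0)
        - (if q then 1 else 0) * (if y = z then 1 else 0)
        - (if s then 1 else 0) * (if x = z then 1 else 0)
        + ((if p ∧ q then 1 else 0) + (if q ∧ s then 1 else 0) + (if p ∧ s then 1 else 0)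
        - (if p ∧ q ∧ s then 1 else 0)) * (if x = y then if x = z then 1 else 0 else 0) := by
    intro x y z
    by_cases hp : p <;> by_cases hq : q <;> by_cases hs : s <;> by_cases hxy : x = y <;>
      by_cases hxz : x = z <;> simp [hp, hq, hs, hxy, hxz] <;> grind
  have h3 : ∑ x ∈ A, ∑ y ∈ B, ∑ z ∈ C, (if x = y then if x = z then (1 : ℤ) else 0 else 0) =
      (A ∩ B ∩ C).card := by
    rw [← Finset.filter_mem_eq_inter, ← Finset.filter_mem_eq_inter, Finset.filter_filter,
      Finset.card_filter]
    push_cast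
    refine Finset.sum_congr rfl fun x _ => ?_
    by_cases hB : x ∈ B <;> by_cases hC : x ∈ C <;> simp [Finset.sum_ite_irrel, hB, hC]
  have h0 : ∑ x ∈ A, ∑ y ∈ B, ∑ z ∈ C, (1 : ℤ) = A.card * B.card * C.card := by
    simp [mul_assoc]
  have h1 : ∑ x ∈ A, ∑ y ∈ B, ∑ z ∈ C, (if x = y then (1 : ℤ) else 0) =
      (A ∩ B).card * C.card := by
    simp [mul_comm]
  have h2 : ∑ x ∈ A, ∑ y ∈ B, ∑ z ∈ C, (if y = z then (1 : ℤ) else 0) =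
      A.card * (B ∩ C).card := by
    simp
  have h2' : ∑ x ∈ A, ∑ y ∈ B, ∑ z ∈ C, (if x = z then (1 : ℤ) else 0) =
      (A ∩ C).card * B.card := by
    simp [mul_comm]
  rw [Finset.card_filter, Finset.sum_product]
  simp only [Finset.sum_product]
  push_cast
  simp only [h, Finset.sum_sub_distrib, Finset.sum_add_distrib, ← Finset.mul_sum, h0, h1, h2, h2',
    h3]

section
variable {V : Type*} [DecidableEq V] (G : SimpleGraph V) [DecidableRel G.Adj] (L : V → Finset ℕ)

theorem card_listColorings_empty :
    (listColorings (G.comap ((↑) : {v // v ∈ (∅ : Finset V)} → V)) fun v => L v).card = 1 := by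
  rw [Finset.card_eq_one]
  refine ⟨fun _ => 0, Finset.ext fun c => ?_⟩
  simp [mem_listColorings, funext_iff]

theorem card_listColorings_singleton (a : V) :
    (listColorings (G.comap ((↑) : {v // v ∈ ({a} : Finset V)} → V)) fun v => L v).card =
      (L a).card := by
  refine Finset.card_nbij' (fun c => c ⟨a, by simp⟩) (fun x _ => x) ?_ ?_ ?_ ?_
  · intro c hc
    exact ((mem_listColorings _).1 hc).1 ⟨a, by simp⟩
  · intro x hx
    refine (mem_listColorings _).2 ⟨fun ⟨v, hv⟩ => ?_, fun ⟨u, hu⟩ ⟨v, hv⟩ huv => ?_⟩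
    · obtain rfl := Finset.mem_singleton.1 hv
      exact hx
    · obtain rfl := Finset.mem_singleton.1 hu
      obtain rfl := Finset.mem_singleton.1 hv
      exact absurd rfl huv.ne
  · intro c _
    funext ⟨v, hv⟩
    obtain rfl := Finset.mem_singleton.1 hv
    rfl
  · intro x _
    rfl

theorem card_listColorings_pair {a b : V} (hab : a ≠ b) :
    (listColorings (G.comap ((↑) : {v // v ∈ ({a, b} : Finset V)} → V)) fun v => L v).card =
      ((L a ×ˢ L b).filter fun t => G.Adj a b → t.1 ≠ t.2).card := by
  refine Finset.card_nbij' (fun c => (c ⟨a, by simp⟩, c ⟨b, by simp⟩))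
    (fun t v => if (v : V) = a then t.1 else t.2) ?_ ?_ ?_ ?_
  · intro c hc
    obtain ⟨h1, h2⟩ := (mem_listColorings _).1 hc
    simp only [Finset.mem_coe, Finset.mem_filter, Finset.mem_product]
    exact ⟨⟨h1 ⟨a, _⟩, h1 ⟨b, _⟩⟩, h2 ⟨a, _⟩ ⟨b, _⟩⟩
  · rintro ⟨x, y⟩ ht
    simp only [Finset.mem_coe, Finset.mem_filter, Finset.mem_product] at ht
    obtain ⟨⟨h1, h2⟩, h3⟩ := ht
    refine (mem_listColorings _).2 ⟨?_, ?_⟩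
    · rintro ⟨v, hv⟩
      simp only [Finset.mem_insert, Finset.mem_singleton] at hv
      rcases hv with rfl | rfl <;> simp [*, hab.symm]
    · rintro ⟨u, hu⟩ ⟨v, hv⟩ huv
      simp only [Finset.mem_insert, Finset.mem_singleton] at hu hv
      rw [SimpleGraph.comap_adj] at huv
      grind [G.adj_comm, G.irrefl]
  · intro c _
    funext ⟨v, hv⟩
    have hv' := hv
    simp only [Finset.mem_insert, Finset.mem_singleton] at hv'
    rcases hv' with rfl | rfl <;> simp [hab.symm]
  · intro x _
    simp [hab.symm]

theorem card_listColorings_triple {a b c : V} (hab : a ≠ b) (hac : a ≠ c) (hbc : b ≠ c) :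
    (listColorings (G.comap ((↑) : {v // v ∈ ({a, b, c} : Finset V)} → V)) fun v => L v).card =
      ((L a ×ˢ L b ×ˢ L c).filter fun t => (G.Adj a b → t.1 ≠ t.2.1) ∧
        (G.Adj b c → t.2.1 ≠ t.2.2) ∧ (G.Adj a c → t.1 ≠ t.2.2)).card := by
  refine Finset.card_nbij' (fun f => (f ⟨a, by simp⟩, f ⟨b, by simp⟩, f ⟨c, by simp⟩))
    (fun t v => if (v : V) = a then t.1 else if (v : V) = b then t.2.1 else t.2.2) ?_ ?_ ?_ ?_
  · intro f hf
    obtain ⟨h1, h2⟩ := (mem_listColorings _).1 hf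
    simp only [Finset.mem_coe, Finset.mem_filter, Finset.mem_product]
    exact ⟨⟨h1 ⟨a, _⟩, h1 ⟨b, _⟩, h1 ⟨c, _⟩⟩, h2 ⟨a, _⟩ ⟨b, _⟩, h2 ⟨b, _⟩ ⟨c, _⟩,
      h2 ⟨a, _⟩ ⟨c, _⟩⟩
  · rintro ⟨x, y, z⟩ ht
    simp only [Finset.mem_coe, Finset.mem_filter, Finset.mem_product] at ht
    obtain ⟨⟨h1, h2, h3⟩, h4, h5, h6⟩ := ht
    refine (mem_listColorings _).2 ⟨?_, ?_⟩
    · rintro ⟨v, hv⟩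
      simp only [Finset.mem_insert, Finset.mem_singleton] at hv
      rcases hv with rfl | rfl | rfl <;> simp [*, hab.symm, hac.symm, hbc.symm]
    · rintro ⟨u, hu⟩ ⟨v, hv⟩ huv
      simp only [Finset.mem_insert, Finset.mem_singleton] at hu hv
      rw [SimpleGraph.comap_adj] at huv
      grind [G.adj_comm, G.irrefl]
  · intro f _
    funext ⟨v, hv⟩
    have hv' := hv
    simp only [Finset.mem_insert, Finset.mem_singleton] at hv'
    rcases hv' with rfl | rfl | rfl <;> simp [hab.symm, hac.symm, hbc.symm]
  · intro x _
    simp [hab.symm, hac.symm, hbc.symm]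

end

/-! ### Sizes of permitted head lists -/

section
variable {V : Type*} [Fintype V] {k : ℕ} {r : V → Finset ℕ}

theorem IsKRestraint.card_sdiff (hr : IsKRestraint k r) (a : V) :
    ((Finset.Icc 1 (k * Fintype.card V) \ r a).card : ℤ) = (k * Fintype.card V : ℕ) - k := by
  rw [Finset.card_sdiff_of_subset (hr a).2, Nat.cast_sub (Finset.card_le_card (hr a).2),
    Nat.card_Icc, (hr a).1]
  simp

theorem IsKRestraint.card_sdiff_inter (hr : IsKRestraint k r) (a b : V) :
    (((Finset.Icc 1 (k * Fintype.card V) \ r a) ∩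
      (Finset.Icc 1 (k * Fintype.card V) \ r b)).card : ℤ) =
      (k * Fintype.card V : ℕ) - 2 * k + (r a ∩ r b).card := by
  have hsub := Finset.union_subset (hr a).2 (hr b).2
  have := Finset.card_union_add_card_inter (r a) (r b)
  rw [← Finset.sdiff_union_distrib, Finset.card_sdiff_of_subset hsub,
    Nat.cast_sub (Finset.card_le_card hsub), Nat.card_Icc]
  rw [(hr a).1, (hr b).1] at this
  simp only [Nat.add_sub_cancel]
  linarith

/-- Serves paths with centre `b`: only the two end restraints can meet, so the union has `3k - |r a
∩ r c|` elements. -/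
theorem IsKRestraint.card_sdiff_inter_inter (hr : IsKRestraint k r) {a b c : V}
    (hab : r a ∩ r b = ∅) (hbc : r b ∩ r c = ∅) :
    (((Finset.Icc 1 (k * Fintype.card V) \ r a) ∩ (Finset.Icc 1 (k * Fintype.card V) \ r b) ∩
      (Finset.Icc 1 (k * Fintype.card V) \ r c)).card : ℤ) =
      (k * Fintype.card V : ℕ) - 3 * k + (r a ∩ r c).card := by
  have hsub := Finset.union_subset (Finset.union_subset (hr a).2 (hr b).2) (hr c).2
  have h1 := Finset.card_union_add_card_inter (r a ∪ r b) (r c)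
  have h2 := Finset.card_union_add_card_inter (r a) (r b)
  rw [Finset.union_inter_distrib_right, hbc, Finset.union_empty] at h1
  rw [hab, Finset.card_empty, (hr a).1, (hr b).1] at h2
  rw [(hr c).1] at h1
  rw [← Finset.sdiff_union_distrib, ← Finset.sdiff_union_distrib, Finset.card_sdiff_of_subset hsub,
    Nat.cast_sub (Finset.card_le_card hsub), Nat.card_Icc]
  simp only [Nat.add_sub_cancel]
  linarith

end

/-! ### Neighbour overlap -/

/-- The part of `neighborOverlap G r` that comes from vertices in `S`. -/
def overlapOn {V : Type*} [DecidableEq V] (G : SimpleGraph V) [DecidableRel G.Adj]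
    (r : V → Finset ℕ) (S : Finset V) : ℕ :=
  ∑ u ∈ S, ∑ v ∈ S, ∑ w ∈ S,
    if G.Adj u v ∧ G.Adj u w ∧ v ≠ w then (r v ∩ r w).card else 0

section
variable {V : Type*} [Fintype V] [DecidableEq V] (G : SimpleGraph V) [DecidableRel G.Adj] {k : ℕ}
  {r : V → Finset ℕ}

theorem neighborOverlap_eq_sum_ite :
    neighborOverlap G r = ∑ u, ∑ v, ∑ w,
      if G.Adj u v ∧ G.Adj u w ∧ v ≠ w then (r v ∩ r w).card else 0 := by
  refine Finset.sum_congr rfl fun u _ => ?_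
  rw [SimpleGraph.neighborFinset_eq_filter, Finset.sum_filter]
  refine Finset.sum_congr rfl fun v _ => ?_
  by_cases h : G.Adj u v
  · simp only [h, if_true, true_and]
    rw [Finset.filter_filter, Finset.sum_filter]
  · simp [h]

/-- Double counting: `u`, `v`, `w` in a nonzero term are distinct, so exactly one 3-set contains
them. -/
theorem sum_overlapOn :
    ∑ S ∈ Finset.powersetCard 3 Finset.univ, overlapOn G r S = neighborOverlap G r := by
  have h : ∀ S : Finset V, overlapOn G r S = ∑ u, ∑ v, ∑ w,
      if u ∈ S ∧ v ∈ S ∧ w ∈ S then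
        (if G.Adj u v ∧ G.Adj u w ∧ v ≠ w then (r v ∩ r w).card else 0) else 0 := by
    intro S
    simp only [ite_and (_ ∈ S), Finset.sum_ite_irrel, Finset.sum_const_zero,
      Finset.sum_ite_mem, Finset.univ_inter]
    rfl
  rw [neighborOverlap_eq_sum_ite, Finset.sum_congr rfl fun S _ => h S, Finset.sum_comm]
  refine Finset.sum_congr rfl fun u _ => ?_
  rw [Finset.sum_comm]
  refine Finset.sum_congr rfl fun v _ => ?_
  rw [Finset.sum_comm]
  refine Finset.sum_congr rfl fun w _ => ?_
  by_cases hc : G.Adj u v ∧ G.Adj u w ∧ v ≠ w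
  · have h3 : ({u, v, w} : Finset V).card = 3 :=
      Finset.card_eq_three.2 ⟨u, v, w, hc.1.ne, hc.2.1.ne, hc.2.2, rfl⟩
    rw [Finset.sum_eq_single_of_mem {u, v, w} (Finset.mem_powersetCard_univ.2 h3)]
    · simp
    · intro S hS hne
      refine if_neg fun hmem => hne (Finset.eq_of_subset_of_card_le ?_ ?_).symm
      · simp only [Finset.insert_subset_iff, Finset.singleton_subset_iff]
        exact hmem
      · rw [h3, Finset.mem_powersetCard_univ.1 hS]
  · simp [hc]

theorem two_mul_neg_A7'' (e : Fin (Fintype.card V) ≃ V) (r : V → Finset ℕ) :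
    2 * -A7'' G e r = neighborOverlap G r := by
  rw [A7'', neg_neg, Finset.mul_sum, neighborOverlap_eq_sum_ite]
  push_cast
  rw [← e.sum_comp]
  refine Finset.sum_congr rfl fun i _ => ?_
  rw [two_mul]
  simp only [Finset.sum_filter]
  nth_rewrite 2 [Finset.sum_comm]
  rw [← Finset.sum_add_distrib, ← e.sum_comp]
  refine Finset.sum_congr rfl fun j _ => ?_
  rw [← Finset.sum_add_distrib, ← e.sum_comp]
  refine Finset.sum_congr rfl fun l _ => ?_
  rw [Finset.inter_comm (r (e l))]
  rcases lt_trichotomy j l with h | h | h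
  · simp [h, h.ne, h.not_gt]
  · simp [h]
  · simp [h, h.ne', h.not_gt, and_comm]

/-- The colours `{1, …, kn}` are cut into `n` consecutive blocks of length `k`. -/
theorem exists_disjoint_restraint (V : Type*) [Fintype V] (k : ℕ) :
    ∃ r : V → Finset ℕ, IsKRestraint k r ∧ ∀ u v, u ≠ v → r u ∩ r v = ∅ := by
  refine ⟨fun v => Finset.Ioc (k * (Fintype.equivFin V v : ℕ))
    (k * ((Fintype.equivFin V v : ℕ) + 1)), fun v => ⟨?_, ?_⟩, fun u v huv => ?_⟩
  · rw [Nat.card_Ioc, mul_add, mul_one, Nat.add_sub_cancel_left]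
  · intro x hx
    have := Nat.mul_le_mul_left k (Fintype.equivFin V v).isLt
    simp only [Finset.mem_Ioc, Finset.mem_Icc, Nat.succ_eq_add_one] at *
    omega
  · rw [← Finset.disjoint_iff_inter_eq_empty, Finset.disjoint_left]
    intro x hu hv
    simp only [Finset.mem_Ioc] at hu hv
    refine huv ((Fintype.equivFin V).injective (Fin.ext (le_antisymm ?_ ?_)))
    · exact Nat.lt_succ_iff.1 (lt_of_mul_lt_mul_left' (hu.1.trans_le hv.2))
    · exact Nat.lt_succ_iff.1 (lt_of_mul_lt_mul_left' (hv.1.trans_le hu.2))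

/-! ### Head counts of sizes up to three, and extremality -/

variable {G}

theorem headCount_congr_of_card_lt_two {r' : V → Finset ℕ} (hr : IsKRestraint k r)
    (hr' : IsKRestraint k r') {S : Finset V} (hS : S.card < 2) :
    headCount G k r S = headCount G k r' S := by
  rcases Nat.lt_succ_iff_lt_or_eq.1 hS with h | h
  · obtain rfl := Finset.card_eq_zero.1 (Nat.lt_one_iff.1 h)
    rw [headCount, headCount, card_listColorings_empty G fun v => _ \ r v,
      card_listColorings_empty G fun v => _ \ r' v]
  · obtain ⟨a, rfl⟩ := Finset.card_eq_one.1 h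
    rw [headCount, headCount, card_listColorings_singleton G fun v => _ \ r v,
      card_listColorings_singleton G fun v => _ \ r' v]
    have h1 := hr.card_sdiff a
    have h2 := hr'.card_sdiff a
    exact_mod_cast h1.trans h2.symm

theorem IsKRestraint.headCount_pair (hr : IsKRestraint k r) {a b : V} (hab : a ≠ b) :
    (headCount G k r {a, b} : ℤ) =
      ((k * Fintype.card V : ℕ) - k) * ((k * Fintype.card V : ℕ) - k) -
        (if G.Adj a b then 1 else 0) *
          ((k * Fintype.card V : ℕ) - 2 * k + (r a ∩ r b).card) := by
  rw [headCount, card_listColorings_pair G (fun v => _ \ r v) hab, card_filter_ne_prod,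
    hr.card_sdiff, hr.card_sdiff, hr.card_sdiff_inter]

theorem headCount_congr_of_card_lt_three {r' : V → Finset ℕ} (hr : IsKRestraint k r)
    (hr' : IsKRestraint k r') (hp : IsProperRestraint G r) (hp' : IsProperRestraint G r')
    {S : Finset V} (hS : S.card < 3) :
    headCount G k r S = headCount G k r' S := by
  rcases Nat.lt_succ_iff_lt_or_eq.1 hS with h | h
  · exact headCount_congr_of_card_lt_two hr hr' h
  · obtain ⟨a, b, hab, rfl⟩ := Finset.card_eq_two.1 h
    have h1 := hr.headCount_pair (G := G) hab
    have h2 := hr'.headCount_pair (G := G) hab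
    by_cases hadj : G.Adj a b
    · rw [hp a b hadj] at h1
      rw [hp' a b hadj] at h2
      exact_mod_cast h1.trans h2.symm
    · simp only [hadj, if_false, zero_mul] at h1 h2
      exact_mod_cast h1.trans h2.symm

/-- Properness makes every edge term constant, so `r` enters only through the triple intersection of
an induced path, as the overlap of its ends. The factor 2 reflects that `overlapOn` counts ordered
pairs. -/
theorem IsKRestraint.two_mul_headCount_triple (hr : IsKRestraint k r)
    (hp : IsProperRestraint G r) {a b c : V} (hab : a ≠ b) (hac : a ≠ c) (hbc : b ≠ c) :
    2 * (headCount G k r {a, b, c} : ℤ) =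
      2 * (((k * Fintype.card V : ℕ) - k) ^ 3 - ((if G.Adj a b then 1 else 0) +
          (if G.Adj b c then 1 else 0) + (if G.Adj a c then 1 else 0)) *
            (((k * Fintype.card V : ℕ) - k) * ((k * Fintype.card V : ℕ) - 2 * k)) +
        ((if G.Adj a b ∧ G.Adj b c then 1 else 0) + (if G.Adj b c ∧ G.Adj a c then 1 else 0) +
          (if G.Adj a b ∧ G.Adj a c then 1 else 0) -
          (if G.Adj a b ∧ G.Adj b c ∧ G.Adj a c then 1 else 0)) *
            ((k * Fintype.card V : ℕ) - 3 * k)) + overlapOn G r {a, b, c} := by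
  have hO : (overlapOn G r {a, b, c} : ℤ) = 2 * (
      (if G.Adj a b ∧ G.Adj b c then ((r a ∩ r c).card : ℤ) else 0) +
      (if G.Adj a b ∧ G.Adj a c then ((r b ∩ r c).card : ℤ) else 0) +
      (if G.Adj b c ∧ G.Adj a c then ((r a ∩ r b).card : ℤ) else 0)) := by
    by_cases h1 : G.Adj a b <;> by_cases h2 : G.Adj b c <;> by_cases h3 : G.Adj a c <;>
      simp [overlapOn, Finset.sum_insert, hab, hac, hbc, hab.symm, hac.symm, hbc.symm, h1, h2, h3,
        G.adj_comm b a, G.adj_comm c a, G.adj_comm c b, Finset.inter_comm (r b) (r a),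
        Finset.inter_comm (r c) (r a), Finset.inter_comm (r c) (r b)] <;> ring
  rw [hO, headCount, card_listColorings_triple G (fun v => _ \ r v) hab hac hbc,
    card_filter_ne_prod_three, hr.card_sdiff, hr.card_sdiff, hr.card_sdiff, hr.card_sdiff_inter,
    hr.card_sdiff_inter, hr.card_sdiff_inter]
  by_cases h1 : G.Adj a b <;> by_cases h2 : G.Adj b c <;> by_cases h3 : G.Adj a c
  all_goals
    try have e1 := hp a b h1
    try have e2 := hp b c h2
    try have e3 := hp a c h3
    simp only [*, and_self, and_true, and_false, if_true, if_false,
      Finset.card_empty]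
  -- The cases in order: triangle, path centred at `b`, path centred at `a`, edge `ab` alone, path
  -- centred at `c`; the rest have at most one edge.
  · rw [hr.card_sdiff_inter_inter e1 e2, e3]
    simp only [Finset.card_empty]
    ring
  · rw [hr.card_sdiff_inter_inter e1 e2]
    simp only [Nat.cast_zero]
    ring
  · rw [Finset.inter_comm (_ \ r a), hr.card_sdiff_inter_inter ((Finset.inter_comm _ _).trans e1) e3]
    simp only [Nat.cast_zero]
    ring
  · simp only [Nat.cast_zero]
    ring
  · rw [Finset.inter_assoc, Finset.inter_comm (_ \ r a),
      hr.card_sdiff_inter_inter e2 ((Finset.inter_comm _ _).trans e3), Finset.inter_comm (r b)]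
    simp only [Nat.cast_zero]
    ring
  all_goals
    try simp only [Nat.cast_zero]
    ring

theorem isProperRestraint_of_mem_RMax {rstar : V → Finset ℕ} (hstar : rstar ∈ RMax G k) :
    IsProperRestraint G rstar := by
  obtain ⟨r, hr, hdisj⟩ := exists_disjoint_restraint V k
  have hsum := sum_headCount_le_of_mem_RMax hstar hr 2 fun S hS =>
    headCount_congr_of_card_lt_two hr hstar.1 hS
  have hle : ∀ S ∈ Finset.powersetCard 2 Finset.univ,
      headCount G k rstar S ≤ headCount G k r S := by
    intro S hS
    obtain ⟨a, b, hab, rfl⟩ := Finset.card_eq_two.1 (Finset.mem_powersetCard_univ.1 hS)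
    rw [← Nat.cast_le (α := ℤ), hr.headCount_pair hab, hstar.1.headCount_pair hab, hdisj a b hab]
    split_ifs
    · rw [Finset.card_empty]
      push_cast
      linarith [Nat.cast_nonneg (α := ℤ) (rstar a ∩ rstar b).card]
    · simp
  -- The disjoint restraint is best on every pair, yet its total is no larger; so equality holds on
  -- each pair.
  have heq := (Finset.sum_eq_sum_iff_of_le hle).1 (le_antisymm (Finset.sum_le_sum hle) hsum)
  intro a b hadj
  have h := heq {a, b} (Finset.mem_powersetCard_univ.2 (Finset.card_pair hadj.ne))
  rw [← Nat.cast_inj (R := ℤ), hr.headCount_pair hadj.ne, hstar.1.headCount_pair hadj.ne,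
    hdisj a b hadj.ne] at h
  simpa [hadj] using h

theorem neighborOverlap_le_of_mem_RMax {rstar : V → Finset ℕ} (hstar : rstar ∈ RMax G k)
    (hr : IsKRestraint k r) (hp : IsProperRestraint G r) :
    neighborOverlap G r ≤ neighborOverlap G rstar := by
  have hpstar := isProperRestraint_of_mem_RMax hstar
  have hsum := sum_headCount_le_of_mem_RMax hstar hr 3 fun S hS =>
    headCount_congr_of_card_lt_three hr hstar.1 hp hpstar hS
  have h : ∀ S ∈ Finset.powersetCard 3 (Finset.univ : Finset V),
      2 * headCount G k r S + overlapOn G rstar S =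
        2 * headCount G k rstar S + overlapOn G r S := by
    intro S hS
    obtain ⟨a, b, c, hab, hac, hbc, rfl⟩ :=
      Finset.card_eq_three.1 (Finset.mem_powersetCard_univ.1 hS)
    have h1 := hr.two_mul_headCount_triple hp hab hac hbc
    have h2 := hstar.1.two_mul_headCount_triple hpstar hab hac hbc
    zify
    linarith
  have h' := Finset.sum_congr rfl h
  rw [Finset.sum_add_distrib, Finset.sum_add_distrib, ← Finset.mul_sum, ← Finset.mul_sum,
    sum_overlapOn, sum_overlapOn] at h'
  omega

end

theorem mainTheorem5 {V : Type*} [Fintype V] [DecidableEq V] (G : SimpleGraph V)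
    [DecidableRel G.Adj] (k : ℕ) (rstar : V → Finset ℕ) (hr : rstar ∈ RMax G k) :
    IsProperRestraint G rstar ∧
    (∀ e : Fin (Fintype.card V) ≃ V,
      IsLeast {a : ℤ | ∃ r : V → Finset ℕ,
        IsKRestraint k r ∧ IsProperRestraint G r ∧ a = A7'' G e r} (A7'' G e rstar)) ∧
    (∀ r : V → Finset ℕ, IsKRestraint k r → IsProperRestraint G r →
      neighborOverlap G r ≤ neighborOverlap G rstar) := by
  have hle : ∀ r : V → Finset ℕ, IsKRestraint k r → IsProperRestraint G r →
      neighborOverlap G r ≤ neighborOverlap G rstar :=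
    fun r hk hp => neighborOverlap_le_of_mem_RMax hr hk hp
  refine ⟨isProperRestraint_of_mem_RMax hr, fun e => ⟨⟨rstar, hr.1,
    isProperRestraint_of_mem_RMax hr, rfl⟩, ?_⟩, hle⟩
  rintro a ⟨r, hk, hp, rfl⟩
  have h1 := two_mul_neg_A7'' G e r
  have h2 := two_mul_neg_A7'' G e rstar
  have h3 : (neighborOverlap G r : ℤ) ≤ neighborOverlap G rstar := by
    exact_mod_cast hle r hk hp
  linarith
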